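/- Let $a:\mathbb{R}\to\mathbb{R}$ satisfy $0\le a\in L^1(\mathbb{R})\cap L^\infty(\mathbb{R})$ and $\int_{\mathbb{R}}a(x)\,dx=1$, and let $u_0:\mathbb{R}\to[0,\infty)$ belong to $L^\infty(\mathbb{R})$. Let $(f*g)(x)=\int_{\mathbb{R}}f(x-y)g(y)\,dy$, let $a^{*n}$ be the $n$-fold convolution power of $a$ ($n\ge1$), and let $f(x)\sim g(x)$, $x\to\infty$, mean $f(x)/g(x)\to1$. A function $b:\mathbb{R}\to[0,\infty)$ is called: - *long-tailed* if there is $\rho\ge 0$ with $b(x)>0$ for all $x\ge\rho$, and $\lim_{x\to\infty} b(x+y)/b(x)=1$ for every $y\ge0$; - *sub-exponential on $\mathbb{R}_+=[0,\infty)$ in the sense of densities* if $b\in L^1(\mathbb{R}_+)\cap L^\infty(\mathbb{R}_+)$, $b$ is long-tailed, and $\int_0^x b(x-y)b(y)\,dy\sim 2\bigl(\int_{\mathbb{R}_+}b(y)\,dy\bigr)b(x)$ as $x\to\infty$; - *sub-exponential on $\mathbb{R}_+$ in the sense of distributions* if $b\in L^\infty(\mathbb{R}_+)$, $b$ is decreasing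 (in the weak sense) to $0$ on $\mathbb{R}_+$, the limit $b(-\infty)=\lim_{x\to-\infty}b(x)$ exists, and $1\!\!1_{\mathbb{R}_+}(x)\bigl(1-b(x)/b(-\infty)\bigr)$ is a sub-exponential probability distribution on $\mathbb{R}_+$; that is, with $b^+(x)=b(x)$ for $x\ge0$ and $b^+(x)=b(-\infty)$ for $x<0$, the function $b^+$ is decreasing and, as a Lebesgue–Stieltjes integral, $$-\int_{\mathbb{R}} b^+(x-y)\,db^+(y)\sim 2\,b(-\infty)\,b(x),\qquad x\to\infty .$$ The following statements hold. 1. Let $\lim_{x\to\pm\infty}u_0(x)=0$. Suppose that there is $p\in L^1(\mathbb{R})$, $p:\mathbb{R}\to[0,\infty)$, such that both $p(s)$ and $p(-s)$ are sub-exponential on $\mathbb{R}_+$ in the sense of densities, and there are $\rho,K>0$ such that $$p(x+\tau)\le Kp(x),\qquad p(-x-\tau)\le Kp(-x)\qquad\text{for all } x\ge\rho,\ \tau\ge0,$$ $$\max\{a(x),u_0(x)\}\le p(x)\qquad\text{for a.a. } |x|\ge\rho.$$ Then for every $\varepsilon\in(0,1)$ there exist $C_\varepsilon,x_\varepsilon>0$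 such that $$(a^{*n}*u_0)(x)\le C_\varepsilon(1+\varepsilon)^n p(x)\qquad\text{for all } |x|>x_\varepsilon,\ n\ge1.$$ 2. Let $\lim_{x\to\infty}u_0(x)=0$ and $\inf_{x\le-\rho_0}u_0(x)>0$ for some $\rho_0\ge0$, and let $u_0$ be of bounded variation on $\mathbb{R}$. Suppose that there is $q\in L^\infty(\mathbb{R})$, $q:\mathbb{R}\to[0,\infty)$, which is decreasing (in the weak sense) to $0$ on $\mathbb{R}$ and sub-exponential on $\mathbb{R}_+$ in the sense of distributions, and there is $\rho>0$ such that $q$ is continuous on $[\rho,\infty)$ and $$\max\Bigl\{\int_x^\infty a(y)\,dy,\ u_0(x)\Bigr\}\le q(x)\qquad\text{for a.a. } x\ge\rho.$$ Then for every $\varepsilon\in(0,1)$ there exist $C_\varepsilon,x_\varepsilon>0$ such that $$(a^{*n}*u_0)(x)\le C_\varepsilon(1+\varepsilon)^n q(x)\qquad\text{for all } x>x_\varepsilon,\ n\ge1.$$ -/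

import Mathlib

open MeasureTheory Filter Topology Set

/-- The convolution `(f * g)(x) = ∫ f (x - y) g y dy` of real functions on the real line
(see `realConv_apply` for this form of the integral). -/
noncomputable def realConv (f g : ℝ → ℝ) : ℝ → ℝ :=
  convolution f g (ContinuousLinearMap.mul ℝ ℝ) volume

theorem realConv_apply (f g : ℝ → ℝ) (x : ℝ) :
    realConv f g x = ∫ y, f (x - y) * g y := by
  simpa [realConv] using
    convolution_eq_swap (f := f) (g := g) (L := ContinuousLinearMap.mul ℝ ℝ)
      (μ := (volume : Measure ℝ)) (x := x)

/-- The `n`-fold convolution power `f * ... * f`, for `n ≥ 1`; the value at `n = 0` is a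
placeholder which is never used. -/
noncomputable def convPow (f : ℝ → ℝ) : ℕ → ℝ → ℝ
  | 0 => 0
  | 1 => f
  | n + 2 => realConv f (convPow f (n + 1))

/-- `f(x) ∼ g(x)` as `x → ∞`, meaning `f(x) / g(x) → 1`. As `0 / 0 = 0`, this forces both
functions to be nonzero for all large arguments. -/
def AsympEquiv (f g : ℝ → ℝ) : Prop :=
  Tendsto (fun x => f x / g x) atTop (𝓝 1)

/-- `u` vanishes at `±∞`. -/
def VanishesAtInfinity (u : ℝ → ℝ) : Prop :=
  Tendsto u atTop (𝓝 0) ∧ Tendsto u atBot (𝓝 0)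

/-- `u` vanishes at `+∞` and is bounded away from `0` near `-∞`. -/
def FrontLike (u : ℝ → ℝ) : Prop :=
  Tendsto u atTop (𝓝 0) ∧ ∃ ρ : ℝ, 0 ≤ ρ ∧ ∃ c : ℝ, 0 < c ∧ ∀ x ≤ -ρ, c ≤ u x

/-- Right-side long-tailed functions. -/
def LongTailed (b : ℝ → ℝ) : Prop :=
  (∃ ρ : ℝ, 0 ≤ ρ ∧ ∀ x ≥ ρ, 0 < b x) ∧
    ∀ y : ℝ, 0 ≤ y → Tendsto (fun x => b (x + y) / b x) atTop (𝓝 1)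

/-- A function `b : ℝ → [0, ∞)` which is sub-exponential on `[0, ∞)` in the sense of
densities. -/
structure SubexpDensity (b : ℝ → ℝ) : Prop where
  nonneg : ∀ x, 0 ≤ b x
  integrable : IntegrableOn b (Ici 0)
  bounded : MemLp b ⊤ (volume.restrict (Ici 0))
  longTailed : LongTailed b
  conv_equiv : AsympEquiv (fun x => ∫ y in (0 : ℝ)..x, b (x - y) * b y)
    (fun x => 2 * (∫ y in Ici (0 : ℝ), b y) * b x)

/-- The Lebesgue–Stieltjes measure `-db` of a decreasing function `b` on the real line: it
gives `(x, y]` the mass `b(x+) - b(y+)`. -/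
noncomputable def negStieltjes (b : ℝ → ℝ) (hb : Antitone b) : Measure ℝ :=
  hb.neg.stieltjesFunction.measure

/-- The convolution `(b ⋆ b)(x) = -∫ b (x - y) db(y)`, the integral being over the whole real
line, of a decreasing function `b` with itself. If `b` is the tail of the distribution of a
random variable, this is the tail of the sum of two independent copies of it. -/
noncomputable def tailConv (b : ℝ → ℝ) (hb : Antitone b) (x : ℝ) : ℝ :=
  ∫ y, b (x - y) ∂(negStieltjes b hb)

/-- The function which is `b` on `[0, ∞)` and the constant `L` on `(-∞, 0)`. For
`L = b(-∞) > 0` it is `L` times the tail of the distribution function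
`1_{[0, ∞)}(x) (1 - b(x) / b(-∞))`. -/
noncomputable def halfLineTail (b : ℝ → ℝ) (L : ℝ) (x : ℝ) : ℝ :=
  if 0 ≤ x then b x else L

/-- A function `b : ℝ → [0, ∞)` which is sub-exponential on `[0, ∞)` in the sense of
distributions: it is bounded and decreasing to `0` on `[0, ∞)`, has a limit `L = b(-∞)`, and
`F(x) = 1_{[0, ∞)}(x) (1 - b(x) / b(-∞))` is a sub-exponential distribution function,
i.e. the tail of `F * F` is asymptotically twice the tail of `F`; multiplied by `L ^ 2`, this
is the relation `(b⁺ ⋆ b⁺)(x) ∼ 2 b(-∞) b(x)` with `b⁺ = halfLineTail b L`. -/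
structure SubexpDistribution (b : ℝ → ℝ) : Prop where
  nonneg : ∀ x, 0 ≤ b x
  bounded : MemLp b ⊤ (volume.restrict (Ici 0))
  antitoneOn : AntitoneOn b (Ici 0)
  tendsto_zero : Tendsto b atTop (𝓝 0)
  conv_equiv : ∃ (L : ℝ) (hL : Antitone (halfLineTail b L)), Tendsto b atBot (𝓝 L) ∧
    AsympEquiv (tailConv (halfLineTail b L) hL) (fun x => 2 * L * b x)

/-! Both parts rest on a supersolution: a bounded `w ≥ 0` with `a * w ≤ (1 + ε) w` everywhere and
`u₀ ≤ C w` almost everywhere. Iteration (`realConv_convPow_le`) gives `a^{*n} * u₀ ≤ C (1 + ε)^n w`,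
and `w` lies below `p` or `q` where the estimate is claimed.

The choice is `p` or `q` truncated at a small level `l` (for densities, also set to `l` on a ball).
Where `w = l`, `a * w ≤ l` because `a` has mass one. Where `w < l`, the point is far out and the
convolution splits at `R` and `x - R`. The piece `y ≤ R` gives almost `p x` by long-tailedness, the
middle piece is small by sub-exponentiality, and the piece `y > x - R` is small because `w` is. This
is `SubexpDensity.exists_realConv_le` for densities. For distributions only the tail of `a` is
controlled, so the middle piece is first turned into a Stieltjes convolution of `q` by Fubini
(`setIntegral_mul_comp_sub_le`). -/

/-! ### Convolution with a probability density and iteration -/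

theorem realConv_eq_integral (f g : ℝ → ℝ) (x : ℝ) :
    realConv f g x = ∫ y, f y * g (x - y) := rfl

theorem ae_comp_sub_left {P : ℝ → Prop} (h : ∀ᵐ y, P y) (x : ℝ) : ∀ᵐ y, P (x - y) :=
  (quasiMeasurePreserving_sub_left_of_right_invariant volume x).ae h

theorem MeasureTheory.MemLp.exists_ae_abs_le {g : ℝ → ℝ} (hg : MemLp g ⊤) :
    ∃ M : ℝ, 0 ≤ M ∧ ∀ᵐ x, |g x| ≤ M := by
  refine ⟨(eLpNorm g ⊤ volume).toReal, ENNReal.toReal_nonneg, ?_⟩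
  have h := ae_le_eLpNormEssSup (f := g) (μ := volume)
  filter_upwards [h] with x hx
  rw [← eLpNorm_exponent_top] at hx
  have := ENNReal.toReal_mono hg.2.ne hx
  simpa using this

theorem integrable_realConv_integrand {f g : ℝ → ℝ} (hf : Integrable f) (hg : MemLp g ⊤)
    (x : ℝ) : Integrable (fun y => f y * g (x - y)) := by
  obtain ⟨M, hM, hgM⟩ := hg.exists_ae_abs_le
  have hm : AEStronglyMeasurable (fun y => g (x - y)) volume :=
    hg.1.comp_quasiMeasurePreserving
      (quasiMeasurePreserving_sub_left_of_right_invariant volume x)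
  refine (hf.bdd_mul (c := M) hm ?_).congr (Eventually.of_forall fun y => mul_comm _ _)
  filter_upwards [ae_comp_sub_left hgM x] with y hy
  simpa using hy

theorem memLp_top_realConv {f g : ℝ → ℝ} (hf : Integrable f) (hg : MemLp g ⊤) :
    MemLp (realConv f g) ⊤ := by
  obtain ⟨M, hM, hgM⟩ := hg.exists_ae_abs_le
  refine memLp_top_of_bound (C := ∫ y, ‖f y‖ * M) ?_ (Eventually.of_forall fun x => ?_)
  · exact (hf.aestronglyMeasurable.convolution_integrand
      (ContinuousLinearMap.mul ℝ ℝ) hg.1).integral_prod_right'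
  · rw [realConv_eq_integral]
    refine norm_integral_le_of_norm_le (hf.norm.mul_const M) ?_
    filter_upwards [ae_comp_sub_left hgM x] with y hy
    rw [norm_mul]
    exact mul_le_mul_of_nonneg_left hy (norm_nonneg _)

theorem realConv_mono {a g h : ℝ → ℝ} (ha : ∀ᵐ x, 0 ≤ a x) (hi : Integrable a)
    (hg : MemLp g ⊤) (hh : MemLp h ⊤) (hgh : ∀ᵐ x, g x ≤ h x) (x : ℝ) :
    realConv a g x ≤ realConv a h x := by
  refine integral_mono_ae (integrable_realConv_integrand hi hg x)
    (integrable_realConv_integrand hi hh x) ?_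
  filter_upwards [ha, ae_comp_sub_left hgh x] with y h1 h2
  exact mul_le_mul_of_nonneg_left h2 h1

theorem realConv_const_mul (a g : ℝ → ℝ) (c x : ℝ) :
    realConv a (fun y => c * g y) x = c * realConv a g x := by
  rw [realConv_eq_integral, realConv_eq_integral, ← integral_const_mul]
  congr 1; ext y; ring

theorem realConv_le_of_le {a g : ℝ → ℝ} (ha : ∀ᵐ x, 0 ≤ a x) (hi : Integrable a)
    (ha1 : ∫ x, a x = 1) (hg : MemLp g ⊤) {c : ℝ} (hgc : ∀ x, g x ≤ c) (x : ℝ) :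
    realConv a g x ≤ c := by
  have h := realConv_mono ha hi hg (memLp_top_const c) (Eventually.of_forall hgc) x
  rwa [realConv_eq_integral a (fun _ => c), integral_mul_const, ha1, one_mul] at h

theorem realConv_assoc {f g k : ℝ → ℝ} (hf : Integrable f) (hg : Integrable g)
    (hk : MemLp k ⊤) (x : ℝ) :
    realConv (realConv f g) k x = realConv f (realConv g k) x := by
  have hk' : MemLp (fun x => ‖k x‖) ⊤ := hk.norm
  refine convolution_assoc _ _ _ _ (fun a b c => mul_assoc a b c) hf.1 hg.1 hk.1
    (hf.ae_convolution_exists _ hg)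
    (Eventually.of_forall fun y => integrable_realConv_integrand hg.norm hk' y) ?_
  exact integrable_realConv_integrand hf.norm (memLp_top_realConv hg.norm hk') x

theorem integrable_convPow {a : ℝ → ℝ} (ha : Integrable a) : ∀ n, Integrable (convPow a n)
  | 0 => integrable_zero _ _ _
  | 1 => ha
  | n + 2 => ha.integrable_convolution _ (integrable_convPow ha (n + 1))

/-- If `w` is a supersolution, `a * w ≤ c w`, which dominates `u` up to the factor `C`, then
`a^{*n} * u` grows at most like `C c ^ n w`. -/
theorem realConv_convPow_le {a u w : ℝ → ℝ} (ha : ∀ᵐ x, 0 ≤ a x) (hi : Integrable a)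
    (hu : MemLp u ⊤) (hw : MemLp w ⊤) {c C : ℝ} (hc : 0 ≤ c) (hC : 0 ≤ C)
    (haw : ∀ x, realConv a w x ≤ c * w x) (huw : ∀ᵐ x, u x ≤ C * w x) :
    ∀ n : ℕ, 1 ≤ n → ∀ x, realConv (convPow a n) u x ≤ C * c ^ n * w x := by
  have key : ∀ (g : ℝ → ℝ) (B : ℝ), 0 ≤ B → MemLp g ⊤ → (∀ᵐ x, g x ≤ B * w x) →
      ∀ x, realConv a g x ≤ B * c * w x := fun g B hB hg h x => by
    refine (realConv_mono ha hi hg (hw.const_mul B) h x).trans ?_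
    rw [realConv_const_mul, mul_assoc]
    exact mul_le_mul_of_nonneg_left (haw x) hB
  intro n hn
  induction n, hn using Nat.le_induction with
  | base => simpa [convPow] using key u C hC hu huw
  | succ n hn ih =>
    obtain ⟨m, rfl⟩ : ∃ m, n = m + 1 := ⟨n - 1, by omega⟩
    intro x
    change realConv (realConv a (convPow a (m + 1))) u x ≤ _
    rw [realConv_assoc hi (integrable_convPow hi _) hu, pow_succ, ← mul_assoc]
    exact key _ _ (by positivity) (memLp_top_realConv (integrable_convPow hi _) hu)
      (Eventually.of_forall ih) x

/-! ### Long-tailed functions and sub-exponential densities -/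

theorem LongTailed.eventually_pos {b : ℝ → ℝ} (hb : LongTailed b) : ∀ᶠ x in atTop, 0 < b x := by
  obtain ⟨ρ, -, h⟩ := hb.1
  filter_upwards [eventually_ge_atTop ρ] with x hx using h x hx

theorem LongTailed.tendsto_sub {b : ℝ → ℝ} (hb : LongTailed b) (y : ℝ) :
    Tendsto (fun x => b (x - y) / b x) atTop (𝓝 1) := by
  rcases le_total y 0 with hy | hy
  · simpa [sub_eq_add_neg] using hb.2 (-y) (by linarith)
  · have h := (hb.2 y hy).comp (tendsto_atTop_add_const_right atTop (-y) tendsto_id)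
    have h' := h.inv₀ one_ne_zero
    simpa [Function.comp_def, sub_eq_add_neg] using h'

/-- Since `x - y ≥ x - R`, quasi-monotonicity costs a factor `K`, and `p (x - R) < 2 p x`
eventually. This is the domination used for limits under the integral. -/
theorem LongTailed.eventually_sub_le {p : ℝ → ℝ} (hp : LongTailed p) {ρ K : ℝ} (hK : 0 < K)
    (hmono : ∀ x τ : ℝ, ρ ≤ x → 0 ≤ τ → p (x + τ) ≤ K * p x) (R : ℝ) :
    ∀ᶠ x in atTop, ∀ y ≤ R, p (x - y) ≤ 2 * K * p x := by
  filter_upwards [(hp.tendsto_sub R).eventually (gt_mem_nhds one_lt_two), hp.eventually_pos,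
    eventually_ge_atTop (ρ + R)] with x h1 h2 h3 y hy
  have h4 := hmono (x - R) (R - y) (by linarith) (by linarith)
  rw [sub_add_sub_cancel] at h4
  rw [div_lt_iff₀ h2] at h1
  nlinarith

theorem integrableOn_mul_comp_sub_left {f p : ℝ → ℝ} (hf : Integrable f) (hp : Integrable p)
    (hp0 : ∀ x, 0 ≤ p x) {ρ K : ℝ}
    (hmono : ∀ x τ : ℝ, ρ ≤ x → 0 ≤ τ → p (x + τ) ≤ K * p x) (x : ℝ) :
    IntegrableOn (fun y => f y * p (x - y)) (Iic (x - ρ)) := by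
  refine (Integrable.bdd_mul (c := K * p ρ) hf.integrableOn
    (hp.comp_sub_left x).aestronglyMeasurable.restrict ?_).congr
    (Eventually.of_forall fun y => mul_comm _ _)
  filter_upwards [ae_restrict_mem measurableSet_Iic] with y hy
  have h := hmono ρ (x - y - ρ) le_rfl (by linarith [mem_Iic.1 hy])
  rw [add_sub_cancel] at h
  rwa [Real.norm_of_nonneg (hp0 _)]

/-- Dominated convergence: `p (x - y) / p x` tends to `1` pointwise and is at most `2 K` for `y ≤
R`. -/
theorem LongTailed.tendsto_setIntegral_div {f p : ℝ → ℝ} (hp : LongTailed p)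
    (hpi : Integrable p) (hp0 : ∀ x, 0 ≤ p x) {ρ K : ℝ} (hK : 0 < K)
    (hmono : ∀ x τ : ℝ, ρ ≤ x → 0 ≤ τ → p (x + τ) ≤ K * p x) (hf : Integrable f)
    {s : Set ℝ} (hs : MeasurableSet s) {R : ℝ} (hsR : s ⊆ Iic R) :
    Tendsto (fun x => (∫ y in s, f y * p (x - y)) / p x) atTop (𝓝 (∫ y in s, f y)) := by
  simp_rw [← integral_div]
  refine tendsto_integral_filter_of_dominated_convergence (fun y => 2 * K * |f y|) ?_ ?_ ?_ ?_
  · refine Eventually.of_forall fun x => ?_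
    exact ((hf.1.mul (hpi.comp_sub_left x).1).aemeasurable.div_const _).aestronglyMeasurable.restrict
  · filter_upwards [hp.eventually_sub_le hK hmono R, hp.eventually_pos] with x h1 h2
    filter_upwards [ae_restrict_mem hs] with y hy
    have h3 := h1 y (hsR hy)
    rw [norm_div, norm_mul, Real.norm_of_nonneg h2.le, Real.norm_of_nonneg (hp0 _),
      Real.norm_eq_abs, div_le_iff₀ h2]
    nlinarith [abs_nonneg (f y)]
  · exact (hf.abs.const_mul _).integrableOn
  · refine Eventually.of_forall fun y => ?_
    simpa [mul_div_assoc] using (hp.tendsto_sub y).const_mul (f y)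

theorem tendsto_integral_abs_gt_zero {p : ℝ → ℝ} (hp : Integrable p) :
    Tendsto (fun R : ℝ => ∫ y in {y | R < |y|}, p y) atTop (𝓝 0) := by
  have hm : ∀ R : ℝ, MeasurableSet {y : ℝ | R < |y|} := fun R =>
    measurableSet_lt measurable_const measurable_abs
  simp_rw [← fun R => integral_indicator (f := p) (μ := volume) (hm R)]
  rw [← integral_zero ℝ ℝ (μ := volume)]
  refine tendsto_integral_filter_of_dominated_convergence (fun y => ‖p y‖) ?_ ?_ hp.norm ?_
  · exact Eventually.of_forall fun R => (hp.indicator (hm R)).1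
  · exact Eventually.of_forall fun R => Eventually.of_forall fun y => norm_indicator_le_norm_self _ _
  · refine Eventually.of_forall fun y => tendsto_const_nhds.congr' ?_
    filter_upwards [eventually_ge_atTop |y|] with R hR
    exact (indicator_of_notMem (by simpa using hR) _).symm

/-- The integrand is symmetric under `y ↦ x - y`, so the two end pieces of `[0, x]` are equal, each
asymptotic to `p x` times the mass of `p` on `(0, R]`. Subtracting them from the total leaves twice
the mass beyond `R`. -/
theorem SubexpDensity.tendsto_middle {p : ℝ → ℝ} (hs : SubexpDensity p) (hpi : Integrable p)
    {ρ K : ℝ} (hK : 0 < K)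
    (hmono : ∀ x τ : ℝ, ρ ≤ x → 0 ≤ τ → p (x + τ) ≤ K * p x) {R : ℝ} (hR : 0 ≤ R)
    (hρR : ρ ≤ R) :
    Tendsto (fun x => (∫ y in Ioc R (x - R), p y * p (x - y)) / p x) atTop
      (𝓝 (2 * ∫ y in Ioi R, p y)) := by
  have h1 : Tendsto (fun x => (∫ y in (0 : ℝ)..x, p (x - y) * p y) / p x) atTop
      (𝓝 (2 * ∫ y in Ici (0 : ℝ), p y)) := by
    -- With zero mass the quotient in `conv_equiv` would be division by zero, hence constantly `0`,
    -- and could not tend to `1`.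
    have hpos : (2 * ∫ y in Ici (0 : ℝ), p y) ≠ 0 := by
      intro h0
      have := hs.conv_equiv
      simp only [AsympEquiv, h0, zero_mul, div_zero] at this
      exact zero_ne_one (tendsto_nhds_unique tendsto_const_nhds this)
    have := (hs.conv_equiv).const_mul (2 * ∫ y in Ici (0 : ℝ), p y)
    rw [mul_one] at this
    refine this.congr fun x => ?_
    rw [mul_div_assoc', mul_div_mul_left _ _ hpos]
  have h2 := hs.longTailed.tendsto_setIntegral_div hpi hs.nonneg hK hmono hpi
    (s := Ioc 0 R) measurableSet_Ioc Ioc_subset_Iic_self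
  have h3 := h1.sub (h2.const_mul 2)
  have h4 : (2 * ∫ y in Ici (0 : ℝ), p y) - 2 * ∫ y in Ioc 0 R, p y = 2 * ∫ y in Ioi R, p y := by
    rw [integral_Ici_eq_integral_Ioi, ← Ioc_union_Ioi_eq_Ioi hR,
      setIntegral_union (Ioc_disjoint_Ioi le_rfl) measurableSet_Ioi hpi.integrableOn
        hpi.integrableOn]
    ring
  rw [h4] at h3
  refine h3.congr' ?_
  filter_upwards [eventually_ge_atTop (2 * R)] with x hx
  rw [mul_div_assoc', ← sub_div]
  congr 1
  have hI := integrableOn_mul_comp_sub_left hpi hpi hs.nonneg hmono x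
  have i1 : IntervalIntegrable (fun y => p y * p (x - y)) volume 0 R :=
    (intervalIntegrable_iff_integrableOn_Ioc_of_le hR).2
      (hI.mono_set fun y hy => by simp only [mem_Iic, mem_Ioc] at *; linarith)
  have i2 : IntervalIntegrable (fun y => p y * p (x - y)) volume R (x - R) :=
    (intervalIntegrable_iff_integrableOn_Ioc_of_le (by linarith)).2
      (hI.mono_set fun y hy => by simp only [mem_Iic, mem_Ioc] at *; linarith)
  have i3 : IntervalIntegrable (fun y => p y * p (x - y)) volume (x - R) x := by
    simpa [mul_comm] using (i1.comp_sub_left x).symm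
  have e3 : ∫ y in (x - R)..x, p y * p (x - y) = ∫ y in (0 : ℝ)..R, p y * p (x - y) := by
    have := intervalIntegral.integral_comp_sub_left (fun y => p y * p (x - y)) x
      (a := x - R) (b := x)
    simp only [sub_sub_cancel, sub_self] at this
    rw [← this]
    congr 1; ext y; ring
  have e : ∫ y in (0 : ℝ)..x, p (x - y) * p y = ∫ y in (0 : ℝ)..x, p y * p (x - y) := by
    simp_rw [mul_comm]
  rw [e, ← intervalIntegral.integral_add_adjacent_intervals (i1.trans i2) i3,
    ← intervalIntegral.integral_add_adjacent_intervals i1 i2, e3,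
    intervalIntegral.integral_of_le hR, intervalIntegral.integral_of_le (by linarith : R ≤ x - R)]
  ring

theorem integral_le_of_le_of_abs_gt {p w : ℝ → ℝ} (hp : Integrable p)
    (hwm : AEStronglyMeasurable w) (hw0 : ∀ x, 0 ≤ w x) {l R : ℝ} (hR : 0 ≤ R)
    (hwl : ∀ x, w x ≤ l) (hwp : ∀ x, R ≤ |x| → w x ≤ p x) :
    Integrable w ∧ ∫ x, w x ≤ 2 * R * l + ∫ y in {y | R < |y|}, p y := by
  have hm : MeasurableSet {y : ℝ | R < |y|} := measurableSet_lt measurable_const measurable_abs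
  have i1 : Integrable ((Icc (-R) R).indicator fun _ => l) :=
    (integrable_indicator_iff measurableSet_Icc).2 (integrableOn_const (by simp))
  have i2 := hp.indicator hm
  have hle : ∀ x, w x ≤ (Icc (-R) R).indicator (fun _ => l) x + {y | R < |y|}.indicator p x := by
    intro x
    by_cases hx : R < |x|
    · have : x ∉ Icc (-R) R := fun h => absurd (abs_le.2 h) (not_le.2 hx)
      simpa [this, indicator, hx] using hwp x hx.le
    · have : x ∈ Icc (-R) R := abs_le.1 (not_lt.1 hx)
      rw [indicator_of_mem this, indicator_of_notMem (by simpa using hx), add_zero]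
      exact hwl x
  have iw : Integrable w := (i1.add i2).mono' hwm
    (Eventually.of_forall fun x => by rw [Real.norm_of_nonneg (hw0 x)]; exact hle x)
  refine ⟨iw, (integral_mono iw (i1.add i2) hle).trans_eq ?_⟩
  simp only [Pi.add_apply]
  rw [integral_add i1 i2, integral_indicator hm, integral_indicator measurableSet_Icc]
  simp [max_eq_left (by linarith : 0 ≤ R + R)]
  left; ring

/-- If `w` is dominated by the sub-exponential density `p` away from a ball and is uniformly
small, then `a * w` is at most slightly larger than `p` near `+∞`, uniformly in `w`. -/
theorem SubexpDensity.exists_realConv_le {a p : ℝ → ℝ} (hs : SubexpDensity p)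
    (hpi : Integrable p) (ha : ∀ᵐ x, 0 ≤ a x) (hai : Integrable a) (ha1 : ∫ x, a x = 1)
    {ρ K : ℝ} (hK : 0 < K) (hmono : ∀ x τ : ℝ, ρ ≤ x → 0 ≤ τ → p (x + τ) ≤ K * p x)
    (hap : ∀ᵐ x, ρ ≤ x → a x ≤ p x) {δ : ℝ} (hδ : 0 < δ) :
    ∀ᶠ R : ℝ in atTop, ∃ l X : ℝ, 0 < l ∧ ∀ w : ℝ → ℝ, AEStronglyMeasurable w →
      (∀ x, 0 ≤ w x) → (∀ x, w x ≤ l) → (∀ x, R ≤ |x| → w x ≤ p x) →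
      ∀ x ≥ X, realConv a w x ≤ (1 + δ) * p x := by
  -- The excess `δ` is spent as `δ/4 + δ/4 + δ/2` on the three pieces. The tail bound `δ/16` serves
  -- the middle piece, `δ/(16 K)` the mass of `w` in the last one.
  filter_upwards [(tendsto_integral_abs_gt_zero hpi).eventually (gt_mem_nhds
    (lt_min (by positivity : 0 < δ / 16) (by positivity : 0 < δ / (16 * K)))),
    eventually_ge_atTop ρ, eventually_ge_atTop 1] with R hsmall hRρ hR1
  have hR0 : 0 < R := by linarith
  have hlK : 0 < δ / (16 * K * R) := by positivity
  have ht1 : ∫ y in Iic R, a y ≤ 1 := ha1 ▸ setIntegral_le_integral hai ha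
  have ht2 : ∫ y in Ioi R, p y ≤ ∫ y in {y | R < |y|}, p y :=
    setIntegral_mono_set hpi.integrableOn (Eventually.of_forall hs.nonneg)
      (Eventually.of_forall fun y (hy : R < y) => hy.trans_le (le_abs_self y))
  have hs1 := hsmall.trans_le (min_le_left _ _)
  have hs2 := hsmall.trans_le (min_le_right _ _)
  have E1 := (hs.longTailed.tendsto_setIntegral_div hpi hs.nonneg hK hmono hai
    (s := Iic R) measurableSet_Iic Subset.rfl).eventually
    (gt_mem_nhds (by linarith : _ < 1 + δ / 4))
  have E2 := (hs.tendsto_middle hpi hK hmono hR0.le hRρ).eventually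
    (gt_mem_nhds (by linarith : _ < δ / 4))
  obtain ⟨X, hX⟩ := eventually_atTop.1 (E1.and (E2.and
    ((hs.longTailed.eventually_sub_le hK hmono R).and
      (hs.longTailed.eventually_pos.and (eventually_ge_atTop (2 * R))))))
  -- At this level the ball of radius `R` contributes at most `2 R l = δ/(8 K)` to the mass of `w`.
  refine ⟨δ / (16 * K * R), X, hlK, fun w hwm hw0 hwl hwp x hx => ?_⟩
  obtain ⟨e1, e2, e3, e4, e5⟩ := hX x hx
  rw [div_lt_iff₀ e4] at e1 e2
  obtain ⟨iw, hw⟩ := integral_le_of_le_of_abs_gt hpi hwm hw0 hR0.le hwl hwp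
  have hwtop : MemLp w ⊤ := memLp_top_of_bound hwm (δ / (16 * K * R))
    (Eventually.of_forall fun x => by rw [Real.norm_of_nonneg (hw0 x)]; exact hwl x)
  have hI := integrable_realConv_integrand hai hwtop x
  have hJ := integrableOn_mul_comp_sub_left hai hpi hs.nonneg hmono x
  have hJp := integrableOn_mul_comp_sub_left hpi hpi hs.nonneg hmono x
  have iws := iw.comp_sub_left x
  have f1 : ∫ y in Iic R, a y * w (x - y) ≤ ∫ y in Iic R, a y * p (x - y) := by
    refine setIntegral_mono_on_ae hI.integrableOn
      (hJ.mono_set (Iic_subset_Iic.2 (by linarith))) measurableSet_Iic ?_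
    filter_upwards [ha] with y hy hyR
    exact mul_le_mul_of_nonneg_left (hwp _ (le_trans (by linarith [mem_Iic.1 hyR])
      (le_abs_self _))) hy
  have f2 : ∫ y in Ioc R (x - R), a y * w (x - y) ≤ ∫ y in Ioc R (x - R), p y * p (x - y) := by
    refine setIntegral_mono_on_ae hI.integrableOn
      (hJp.mono_set fun y hy => by simp only [mem_Iic, mem_Ioc] at *; linarith)
      measurableSet_Ioc ?_
    filter_upwards [hap] with y hy hyR
    exact mul_le_mul (hy (by linarith [hyR.1])) (hwp _ (le_trans (by linarith [hyR.2])
      (le_abs_self _))) (hw0 _) (hs.nonneg _)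
  -- Here `x - y < R`, so `a y ≤ p y = p (x - (x - y)) ≤ 2 K p x`.
  have f3 : ∫ y in Ioi (x - R), a y * w (x - y) ≤ 2 * K * p x * ∫ y, w y := by
    rw [← integral_sub_left_eq_self w volume x, ← integral_const_mul]
    refine le_trans (setIntegral_mono_on_ae hI.integrableOn (iws.const_mul _).integrableOn
      measurableSet_Ioi ?_) (setIntegral_le_integral (iws.const_mul _) ?_)
    · filter_upwards [hap] with y hy hyR
      refine mul_le_mul_of_nonneg_right ((hy (by linarith [mem_Ioi.1 hyR])).trans ?_) (hw0 _)
      simpa using e3 (x - y) (by linarith [mem_Ioi.1 hyR])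
    · exact Eventually.of_forall fun y => mul_nonneg (by positivity) (hw0 _)
  have split : realConv a w x = (∫ y in Iic R, a y * w (x - y)) +
      ((∫ y in Ioc R (x - R), a y * w (x - y)) + ∫ y in Ioi (x - R), a y * w (x - y)) := by
    rw [realConv_eq_integral, ← setIntegral_union (Ioc_disjoint_Ioi le_rfl) measurableSet_Ioi
      hI.integrableOn hI.integrableOn, Ioc_union_Ioi_eq_Ioi (by linarith), ← compl_Iic,
      integral_add_compl measurableSet_Iic hI]
  have f4 : 2 * K * p x * ∫ y, w y ≤ δ / 2 * p x := by
    have : ∫ y, w y ≤ δ / (4 * K) := by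
      refine hw.trans ?_
      have e : 2 * R * (δ / (16 * K * R)) = δ / (8 * K) := by field_simp; ring
      have e' : δ / (4 * K) = δ / (8 * K) + 2 * (δ / (16 * K)) := by field_simp; ring
      have : 0 < δ / (16 * K) := by positivity
      linarith
    calc 2 * K * p x * ∫ y, w y ≤ 2 * K * p x * (δ / (4 * K)) :=
          mul_le_mul_of_nonneg_left this (by positivity)
      _ = δ / 2 * p x := by field_simp; ring
  rw [split]
  linarith

theorem realConv_comp_neg (f g : ℝ → ℝ) (x : ℝ) :
    realConv (fun y => f (-y)) (fun y => g (-y)) x = realConv f g (-x) := by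
  rw [realConv_eq_integral, realConv_eq_integral,
    ← integral_neg_eq_self (fun y => f y * g (-x - y))]
  congr 1; ext y
  congr 2; ring

theorem ae_comp_neg {P : ℝ → Prop} (h : ∀ᵐ y, P y) : ∀ᵐ y, P (-y) :=
  (Measure.measurePreserving_neg (volume : Measure ℝ)).quasiMeasurePreserving.ae h

theorem SubexpDensity.realConv_convPow_le {a u p : ℝ → ℝ}
    (ha : ∀ᵐ x, 0 ≤ a x) (hai : Integrable a) (ha1 : ∫ x, a x = 1) (hu : MemLp u ⊤)
    (hpi : Integrable p) (hs : SubexpDensity p) (hs' : SubexpDensity (fun s => p (-s)))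
    {ρ K : ℝ} (hρ : 0 < ρ) (hK : 0 < K)
    (hmono : ∀ x τ : ℝ, ρ ≤ x → 0 ≤ τ →
      p (x + τ) ≤ K * p x ∧ p (-x - τ) ≤ K * p (-x))
    (hle : ∀ᵐ x : ℝ, ρ ≤ |x| → max (a x) (u x) ≤ p x) {ε : ℝ} (hε : 0 < ε) :
    ∃ C X : ℝ, 0 < C ∧ 0 < X ∧ ∀ x : ℝ, X < |x| → ∀ n : ℕ, 1 ≤ n →
      realConv (convPow a n) u x ≤ C * (1 + ε) ^ n * p x := by
  have hap : ∀ᵐ x, ρ ≤ x → a x ≤ p x := by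
    filter_upwards [hle] with x hx hxρ
    exact (le_max_left _ _).trans (hx (hxρ.trans (le_abs_self x)))
  have hap' : ∀ᵐ x, ρ ≤ x → a (-x) ≤ p (-x) := by
    filter_upwards [ae_comp_neg hle] with x hx hxρ
    exact (le_max_left _ _).trans (hx (by rw [abs_neg]; exact hxρ.trans (le_abs_self x)))
  have ev₁ := hs.exists_realConv_le hpi ha hai ha1 hK
    (fun x τ hx hτ => (hmono x τ hx hτ).1) hap hε
  have ev₂ := hs'.exists_realConv_le (a := fun s => a (-s)) hpi.comp_neg (ae_comp_neg ha)
    hai.comp_neg (by rwa [integral_neg_eq_self (fun s => a s)]) hK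
    (fun x τ hx hτ => by
      simpa only [neg_add, sub_eq_add_neg] using (hmono x τ hx hτ).2) hap' hε
  obtain ⟨r, ⟨l₁, X₁, hl₁, H₁⟩, ⟨l₂, X₂, hl₂, H₂⟩, hρr⟩ :=
    (ev₁.and (ev₂.and (eventually_ge_atTop ρ))).exists
  obtain ⟨T, hT₁, hT₂, hT⟩ := (hs.longTailed.eventually_pos.and
    (hs'.longTailed.eventually_pos.and (eventually_ge_atTop (max X₁ X₂)))).exists
  -- Lowering `l` keeps both one-sided estimates, which are uniform in `w`. The bounds by `p (±T) /
  -- K` push the region `p < l` outside the ball of radius `T`, by quasi-monotonicity.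
  set l := min (min l₁ l₂) (min (p T / K) (p (-T) / K)) with hl
  have hl0 : 0 < l := lt_min (lt_min hl₁ hl₂) (lt_min (div_pos hT₁ hK) (div_pos hT₂ hK))
  have hll₁ : l ≤ l₁ := (min_le_left _ _).trans (min_le_left _ _)
  have hll₂ : l ≤ l₂ := (min_le_left _ _).trans (min_le_right _ _)
  have hlT : l * K ≤ p T :=
    (le_div_iff₀ hK).1 ((min_le_right _ _).trans (min_le_left _ _))
  have hlT' : l * K ≤ p (-T) :=
    (le_div_iff₀ hK).1 ((min_le_right _ _).trans (min_le_right _ _))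
  have hbelow : ∀ x, r ≤ |x| → p x < l → T < |x| := by
    intro x hx hxl
    by_contra! hxT
    have hlt : K * p x < l * K := by rw [mul_comm l]; exact mul_lt_mul_of_pos_left hxl hK
    rcases le_total 0 x with h | h
    · rw [abs_of_nonneg h] at hx hxT
      have := (hmono x (T - x) (hρr.trans hx) (by linarith)).1
      rw [add_sub_cancel] at this
      linarith
    · rw [abs_of_nonpos h] at hx hxT
      have := (hmono (-x) (T + x) (hρr.trans hx) (by linarith)).2
      rw [show - -x - (T + x) = -T by ring, neg_neg] at this
      linarith
  -- Near the origin `p` need not dominate `u` and may vanish, so `w` is set to `l` there.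
  set w : ℝ → ℝ := fun x => if |x| < r then l else min l (p x) with hw
  have hw0 : ∀ x, 0 ≤ w x := fun x => by
    by_cases h : |x| < r
    · simp [hw, h, hl0.le]
    · simp [hw, h, hl0.le, hs.nonneg x]
  have hwl : ∀ x, w x ≤ l := fun x => by
    by_cases h : |x| < r <;> simp [hw, h]
  have hwp : ∀ x, r ≤ |x| → w x ≤ p x := fun x h => by simp [hw, h.not_gt]
  have hw_cases : ∀ x, w x = l ∨ r ≤ |x| ∧ p x < l ∧ w x = p x := fun x => by
    by_cases h : |x| < r
    · left; simp [hw, h]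
    · rcases lt_or_ge (p x) l with h' | h'
      · right; exact ⟨not_lt.1 h, h', by simp [hw, h, h'.le]⟩
      · left; simp [hw, h, h']
  have hwm : AEStronglyMeasurable w := by
    have hset : MeasurableSet {x : ℝ | |x| < r} :=
      measurableSet_lt measurable_abs measurable_const
    refine ((aestronglyMeasurable_const (b := l)).indicator hset |>.add
      ((aemeasurable_const (b := l) |>.min hpi.1.aemeasurable).aestronglyMeasurable.indicator
        hset.compl)).congr (Eventually.of_forall fun x => ?_)
    by_cases h : |x| < r <;> simp [hw, h]
  have hwtop : MemLp w ⊤ := memLp_top_of_bound hwm l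
    (Eventually.of_forall fun x => by rw [Real.norm_of_nonneg (hw0 x)]; exact hwl x)
  have haw : ∀ x, realConv a w x ≤ (1 + ε) * w x := by
    intro x
    rcases hw_cases x with h | ⟨hrx, hpl, h⟩
    · rw [h]
      have := realConv_le_of_le ha hai ha1 hwtop hwl x
      nlinarith
    · rw [h]
      have hTx := hbelow x hrx hpl
      rcases le_total 0 x with h0 | h0
      · rw [abs_of_nonneg h0] at hTx
        exact H₁ w hwm hw0 (fun x => (hwl x).trans hll₁) hwp x
          (by linarith [(le_max_left X₁ X₂).trans hT])
      · rw [abs_of_nonpos h0] at hTx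
        have := H₂ (fun s => w (-s))
          (hwm.comp_quasiMeasurePreserving
            (Measure.measurePreserving_neg volume).quasiMeasurePreserving)
          (fun x => hw0 _) (fun x => (hwl _).trans hll₂)
          (fun x hx => hwp _ (by rwa [abs_neg])) (-x)
          (by linarith [(le_max_right X₁ X₂).trans hT])
        rwa [realConv_comp_neg, neg_neg] at this
  obtain ⟨M, hM, huM⟩ := hu.exists_ae_abs_le
  -- The term `M / l` covers the points where `w = l`, the term `1` those where `w = p`.
  have hC : 0 < 1 + M / l := by positivity
  have huw : ∀ᵐ x, u x ≤ (1 + M / l) * w x := by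
    filter_upwards [huM, hle] with x hx hx'
    rcases hw_cases x with h | ⟨hrx, -, h⟩
    · rw [h, add_mul, div_mul_cancel₀ _ hl0.ne']
      linarith [le_abs_self (u x)]
    · rw [h]
      have h1 := (le_max_right _ _).trans (hx' (hρr.trans hrx))
      have h2 := mul_nonneg (div_nonneg hM hl0.le) (hs.nonneg x)
      linarith
  refine ⟨1 + M / l, r, hC, hρ.trans_le hρr, fun x hx n hn => ?_⟩
  refine (_root_.realConv_convPow_le ha hai hu hwtop (by linarith) hC.le haw huw n hn x).trans ?_
  exact mul_le_mul_of_nonneg_left (hwp x hx.le) (by positivity)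

/-! ### The Stieltjes measure of a tail -/

section StieltjesTail

variable {q : ℝ → ℝ} {L : ℝ}

theorem halfLineTail_of_nonneg {x : ℝ} (hx : 0 ≤ x) : halfLineTail q L x = q x := if_pos hx

theorem halfLineTail_of_neg {x : ℝ} (hx : x < 0) : halfLineTail q L x = L := if_neg (not_le.2 hx)

theorem halfLineTail_nonneg (hL : Antitone (halfLineTail q L)) (hq : Tendsto q atTop (𝓝 0))
    (x : ℝ) : 0 ≤ halfLineTail q L x := by
  refine hL.le_of_tendsto (hq.congr' ?_) x
  filter_upwards [eventually_ge_atTop 0] with y hy using (halfLineTail_of_nonneg hy).symm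

theorem halfLineTail_le (hL : Antitone (halfLineTail q L)) (x : ℝ) : halfLineTail q L x ≤ L := by
  refine hL.ge_of_tendsto (tendsto_const_nhds.congr' ?_) x
  filter_upwards [eventually_lt_atBot 0] with y hy using (halfLineTail_of_neg hy).symm

theorem stieltjesFunction_tendsto_atTop (hL : Antitone (halfLineTail q L))
    (hq : Tendsto q atTop (𝓝 0)) : Tendsto hL.neg.stieltjesFunction atTop (𝓝 0) := by
  refine tendsto_rightLim_atTop_of_tendsto ?_
  rw [← neg_zero]
  refine Tendsto.neg (hq.congr' ?_)
  filter_upwards [eventually_ge_atTop 0] with y hy using (halfLineTail_of_nonneg hy).symm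

theorem stieltjesFunction_tendsto_atBot (hL : Antitone (halfLineTail q L)) :
    Tendsto hL.neg.stieltjesFunction atBot (𝓝 (-L)) := by
  refine tendsto_rightLim_atBot_of_tendsto (Tendsto.neg (tendsto_const_nhds.congr' ?_))
  filter_upwards [eventually_lt_atBot 0] with y hy using (halfLineTail_of_neg hy).symm

theorem isFiniteMeasure_negStieltjes (hL : Antitone (halfLineTail q L))
    (hq : Tendsto q atTop (𝓝 0)) : IsFiniteMeasure (negStieltjes (halfLineTail q L) hL) :=
  StieltjesFunction.isFiniteMeasure _ (stieltjesFunction_tendsto_atBot hL)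
    (stieltjesFunction_tendsto_atTop hL hq)

/-- The Stieltjes function takes right limits; continuity identifies them with values, and `0 < x`
avoids the possible jump of `halfLineTail` at `0`. -/
theorem stieltjesFunction_eq (hL : Antitone (halfLineTail q L)) {x : ℝ} (hx : 0 < x)
    (hc : ContinuousAt q x) : hL.neg.stieltjesFunction x = -q x := by
  rw [Monotone.stieltjesFunction_eq]
  have hc' : ContinuousAt (fun x => -halfLineTail q L x) x := by
    refine (hc.congr ?_).neg
    filter_upwards [eventually_gt_nhds hx] with y hy using (halfLineTail_of_nonneg hy.le).symm
  rw [hc'.continuousWithinAt.rightLim_eq, halfLineTail_of_nonneg hx.le]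

theorem negStieltjes_Ioc (hL : Antitone (halfLineTail q L)) {x y : ℝ} (hx : 0 < x) (hxy : x ≤ y)
    (hcx : ContinuousAt q x) (hcy : ContinuousAt q y) :
    (negStieltjes (halfLineTail q L) hL).real (Ioc x y) = q x - q y := by
  have h : q y ≤ q x := by
    simpa [halfLineTail_of_nonneg, hx.le, hx.le.trans hxy] using hL hxy
  rw [measureReal_def, negStieltjes, StieltjesFunction.measure_Ioc,
    stieltjesFunction_eq hL hx hcx, stieltjesFunction_eq hL (hx.trans_le hxy) hcy,
    ENNReal.toReal_ofReal (by linarith)]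
  ring

theorem negStieltjes_Ioi (hL : Antitone (halfLineTail q L)) (hq : Tendsto q atTop (𝓝 0))
    {x : ℝ} (hx : 0 < x) (hc : ContinuousAt q x) :
    (negStieltjes (halfLineTail q L) hL).real (Ioi x) = q x := by
  have h := halfLineTail_nonneg hL hq x
  rw [halfLineTail_of_nonneg hx.le] at h
  rw [measureReal_def, negStieltjes,
    StieltjesFunction.measure_Ioi _ (stieltjesFunction_tendsto_atTop hL hq),
    stieltjesFunction_eq hL hx hc, ENNReal.toReal_ofReal (by linarith)]
  ring

theorem negStieltjes_Iic (hL : Antitone (halfLineTail q L))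
    {x : ℝ} (hx : 0 < x) (hc : ContinuousAt q x) :
    (negStieltjes (halfLineTail q L) hL).real (Iic x) = L - q x := by
  have h := halfLineTail_le hL x
  rw [halfLineTail_of_nonneg hx.le] at h
  rw [measureReal_def, negStieltjes,
    StieltjesFunction.measure_Iic _ (stieltjesFunction_tendsto_atBot hL),
    stieltjesFunction_eq hL hx hc, ENNReal.toReal_ofReal (by linarith)]
  ring

theorem ae_negStieltjes_nonneg (hL : Antitone (halfLineTail q L)) :
    ∀ᵐ y ∂(negStieltjes (halfLineTail q L) hL), 0 ≤ y := by
  have h : negStieltjes (halfLineTail q L) hL (Iio 0) = 0 := by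
    rw [negStieltjes, StieltjesFunction.measure_Iio _ (stieltjesFunction_tendsto_atBot hL),
      ENNReal.ofReal_eq_zero, sub_nonpos]
    refine le_of_tendsto (hL.neg.stieltjesFunction.mono.tendsto_leftLim 0) ?_
    filter_upwards [self_mem_nhdsWithin] with y (hy : y < 0)
    -- The right limit at `y` is bounded by a value further right; `y / 2` is still negative.
    have h := hL.neg.rightLim_le (show y < y / 2 by linarith)
    rwa [halfLineTail_of_neg (by linarith)] at h
  filter_upwards [measure_eq_zero_iff_ae_notMem.1 h] with y hy using not_lt.1 hy

theorem integrable_halfLineTail_comp_sub (hL : Antitone (halfLineTail q L))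
    (hq : Tendsto q atTop (𝓝 0)) (x : ℝ) :
    Integrable (fun y => halfLineTail q L (x - y)) (negStieltjes (halfLineTail q L) hL) := by
  have := isFiniteMeasure_negStieltjes hL hq
  refine Integrable.of_bound (C := L)
    (hL.measurable.comp (measurable_const.sub measurable_id)).aestronglyMeasurable
    (Eventually.of_forall fun y => ?_)
  rw [Real.norm_of_nonneg (halfLineTail_nonneg hL hq _)]
  exact halfLineTail_le hL _

/-- The mass of `b ⋆ b` at `x` outside a set of intermediate arguments is at least
`(2 L - q R) q x`. -/
theorem setIntegral_add_le_tailConv (hL : Antitone (halfLineTail q L))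
    (hq : Tendsto q atTop (𝓝 0)) {R x : ℝ} (hR : 0 < R) (hRx : R ≤ x)
    (hcR : ContinuousAt q R) (hcx : ContinuousAt q x) {s : Set ℝ}
    (hsR : s ⊆ Ioc R x) :
    (∫ y in s, halfLineTail q L (x - y) ∂(negStieltjes (halfLineTail q L) hL)) +
      (2 * L - q R) * q x ≤ tailConv (halfLineTail q L) hL x := by
  have := isFiniteMeasure_negStieltjes hL hq
  have hI := integrable_halfLineTail_comp_sub hL hq x
  set b := halfLineTail q L with hb
  set μ := negStieltjes b hL with hμ
  have hx : 0 < x := hR.trans_le hRx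
  have e1 : ∫ y in Ioi x, b (x - y) ∂μ = L * q x := by
    rw [setIntegral_congr_fun (g := fun _ => L) measurableSet_Ioi
      fun y hy => halfLineTail_of_neg (by linarith [mem_Ioi.1 hy])]
    rw [setIntegral_const, negStieltjes_Ioi hL hq hx hcx, smul_eq_mul, mul_comm]
  -- The measure lives on `y ≥ 0`, where `b (x - y) ≥ b x`.
  have e2 : (L - q R) * q x ≤ ∫ y in Iic R, b (x - y) ∂μ := by
    rw [← negStieltjes_Iic hL hR hcR, ← smul_eq_mul, ← setIntegral_const]
    refine setIntegral_mono_on_ae (integrable_const _).integrableOn hI.integrableOn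
      measurableSet_Iic ?_
    filter_upwards [ae_negStieltjes_nonneg hL] with y hy hyR
    rw [← halfLineTail_of_nonneg (q := q) (L := L) hx.le]
    exact hL (by linarith)
  have e3 : ∫ y in s, b (x - y) ∂μ ≤ ∫ y in Ioc R x, b (x - y) ∂μ :=
    setIntegral_mono_set hI.integrableOn
      (Eventually.of_forall fun y => halfLineTail_nonneg hL hq _) hsR.eventuallyLE
  have e : tailConv b hL x = (∫ y in Iic R, b (x - y) ∂μ) +
      ((∫ y in Ioc R x, b (x - y) ∂μ) + ∫ y in Ioi x, b (x - y) ∂μ) := by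
    rw [← setIntegral_union (Ioc_disjoint_Ioi le_rfl) measurableSet_Ioi
      hI.integrableOn hI.integrableOn, Ioc_union_Ioi_eq_Ioi hRx, ← compl_Iic,
      integral_add_compl measurableSet_Iic hI, tailConv]
  rw [e, e1]
  linarith

end StieltjesTail

/-! ### Sub-exponential distributions -/

/-- Positivity comes from the convention `t / 0 = 0`: a quotient tending to `1` has an eventually
nonzero denominator. -/
theorem AsympEquiv.eventually_le {f g : ℝ → ℝ} {c : ℝ} (h : AsympEquiv f fun x => 2 * c * g x)
    (hc : 0 ≤ c) (hg : ∀ x, 0 ≤ g x) :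
    0 < c ∧ (∀ᶠ x in atTop, 0 < g x) ∧ ∀ η > 0, ∀ᶠ x in atTop, f x ≤ (2 * c + η) * g x := by
  have hne : ∀ᶠ x in atTop, f x / (2 * c * g x) ≠ 0 := by
    filter_upwards [h.eventually (lt_mem_nhds zero_lt_one)] with x hx using hx.ne'
  have hc0 : 0 < c := by
    obtain ⟨x, hx⟩ := hne.exists
    exact hc.lt_of_ne (by rintro rfl; simp at hx)
  have hg0 : ∀ᶠ x in atTop, 0 < g x := by
    filter_upwards [hne] with x hx
    exact (hg x).lt_of_ne (by intro h; simp [← h] at hx)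
  refine ⟨hc0, hg0, fun η hη => ?_⟩
  have h1 : (1 : ℝ) < 1 + η / (2 * c) := lt_add_of_pos_right _ (by positivity)
  filter_upwards [h.eventually (gt_mem_nhds h1), hg0] with x hx hx0
  rw [div_lt_iff₀ (by positivity)] at hx
  refine hx.le.trans_eq ?_
  field_simp

/-- Integration by parts through Fubini: `q (x - y)` is `q (x - R)` plus the Stieltjes mass of `(x -
y, x - R]`. After swapping over `x < y + s`, the integral of `a` in `y` is at most its tail at `x -
s`, hence at most `q (x - s)`. -/
theorem setIntegral_mul_comp_sub_le {a q : ℝ → ℝ} {L : ℝ} (hL : Antitone (halfLineTail q L))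
    (hq : Tendsto q atTop (𝓝 0)) (ha : ∀ᵐ x, 0 ≤ a x) (hai : Integrable a) {R x : ℝ}
    (hR : 0 < R) (hRx : 2 * R ≤ x) (hc : ∀ y ≥ R, ContinuousAt q y)
    (hA : ∀ y ≥ R, ∫ z in Ioi y, a z ≤ q y) :
    ∫ y in Ioc R (x - R), a y * q (x - y) ≤ q (x - R) * q R +
      ∫ y in Ioc R (x - R), halfLineTail q L (x - y) ∂(negStieltjes (halfLineTail q L) hL) := by
  have := isFiniteMeasure_negStieltjes hL hq
  have hI := integrable_halfLineTail_comp_sub hL hq x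
  set μ := negStieltjes (halfLineTail q L) hL
  set S := Ioc R (x - R) with hS
  set E : Set (ℝ × ℝ) := {z | x < z.1 + z.2} with hE
  have hEm : MeasurableSet E :=
    measurableSet_lt measurable_const (measurable_fst.add measurable_snd)
  set F : ℝ → ℝ → ℝ := fun y s => a y * E.indicator 1 (y, s) with hF
  have hq0 : ∀ y, 0 ≤ y → 0 ≤ q y := fun y hy => by
    simpa [halfLineTail_of_nonneg hy] using halfLineTail_nonneg hL hq y
  have hFi : Integrable (Function.uncurry F) ((volume.restrict S).prod (μ.restrict S)) := by
    have h1 : Integrable (fun z : ℝ × ℝ => a z.1 * 1) ((volume.restrict S).prod (μ.restrict S)) :=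
      Integrable.mul_prod (f := a) (g := fun _ => (1 : ℝ)) hai.integrableOn (integrable_const _)
    refine (h1.indicator hEm).congr (Eventually.of_forall fun z => ?_)
    by_cases hz : z ∈ E <;> simp [hF, Function.uncurry, hz]
  have inner : ∀ y ∈ S, a y * q (x - y) = a y * q (x - R) + ∫ s in S, F y s ∂μ := by
    intro y hy
    have e : ∫ s in S, F y s ∂μ = a y * (q (x - y) - q (x - R)) := by
      simp only [hF]
      rw [integral_const_mul]
      congr 1
      have : ∀ s, E.indicator (1 : ℝ × ℝ → ℝ) (y, s) = (Ioi (x - y)).indicator 1 s := fun s => by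
        by_cases h : x < y + s
        · simp [hE, h, indicator, sub_lt_iff_lt_add']
        · simp [hE, h, indicator, sub_lt_iff_lt_add']
      simp_rw [this]
      rw [integral_indicator_one measurableSet_Ioi, measureReal_restrict_apply measurableSet_Ioi,
        ← negStieltjes_Ioc hL (by linarith [hy.2]) (by linarith [hy.1])
          (hc _ (by linarith [hy.2])) (hc _ (by linarith))]
      congr 1
      ext s
      simp only [hS, mem_inter_iff, mem_Ioi, mem_Ioc]
      constructor
      · rintro ⟨h1, h2, h3⟩; exact ⟨h1, h3⟩
      · rintro ⟨h1, h3⟩; exact ⟨h1, by linarith [hy.2], h3⟩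
    rw [e]; ring
  have hSm : MeasurableSet S := measurableSet_Ioc
  have hle : ∫ y in S, a y ≤ q R :=
    (setIntegral_mono_set hai.integrableOn (ae_restrict_of_ae ha)
      Ioc_subset_Ioi_self.eventuallyLE).trans (hA R le_rfl)
  have hF1 : IntegrableOn (fun y => ∫ s in S, F y s ∂μ) S := hFi.integral_prod_left
  have hF2 : IntegrableOn (fun s => ∫ y in S, F y s) S μ := hFi.integral_prod_right
  rw [setIntegral_congr_fun hSm inner, integral_add (hai.mul_const _).integrableOn hF1,
    integral_mul_const, mul_comm, integral_integral_swap hFi]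
  refine add_le_add (mul_le_mul_of_nonneg_left hle (hq0 _ (by linarith)))
    (setIntegral_mono_on hF2 hI.integrableOn hSm fun s hs => ?_)
  rw [halfLineTail_of_nonneg (by linarith [hs.2])]
  refine le_trans ?_ (hA (x - s) (by linarith [hs.2]))
  rw [← integral_indicator measurableSet_Ioi]
  refine le_trans (le_of_eq ?_) (setIntegral_le_integral (s := S)
    (hai.indicator measurableSet_Ioi) ?_)
  · congr 1; ext y
    by_cases h : x < y + s
    · simp [hF, hE, h, indicator, sub_lt_iff_lt_add]
    · simp [hF, hE, h, indicator, sub_lt_iff_lt_add]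
  · filter_upwards [ha] with y hy
    exact indicator_nonneg (fun _ _ => hy) _

/-- A strict failure at `x` would persist slightly to the left, as `q` is continuous and the tail of
`a` decreasing; but good points are dense. -/
theorem integral_Ioi_le_of_ae {a q : ℝ → ℝ} (ha : ∀ᵐ x, 0 ≤ a x) (hai : Integrable a) {ρ x : ℝ}
    (h : ∀ᵐ x, ρ ≤ x → ∫ y in Ioi x, a y ≤ q x) (hx : ρ < x) (hc : ContinuousAt q x) :
    ∫ y in Ioi x, a y ≤ q x := by
  by_contra! hlt
  obtain ⟨c, hcx, hcs⟩ := exists_Ioc_subset_of_mem_nhds (hc.eventually (gt_mem_nhds hlt))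
    ⟨ρ, hx⟩
  obtain ⟨z, hz, hz1, hz2⟩ := (Measure.dense_of_ae h).exists_between (max_lt hx hcx)
  have h1 : q z < ∫ y in Ioi x, a y := hcs ⟨(le_max_right _ _).trans_lt hz1, hz2.le⟩
  have h2 : ∫ y in Ioi x, a y ≤ ∫ y in Ioi z, a y :=
    setIntegral_mono_set hai.integrableOn (ae_restrict_of_ae ha)
      (Ioi_subset_Ioi hz2.le).eventuallyLE
  linarith [hz ((le_max_left _ _).trans hz1.le)]

/-- Tails of sub-exponential distributions are long-tailed. -/
theorem eventually_comp_sub_le {q : ℝ → ℝ} {L R : ℝ} (hL : Antitone (halfLineTail q L))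
    (hq : Tendsto q atTop (𝓝 0)) (hR : 0 < R) (hc : ∀ y ≥ R, ContinuousAt q y) (hqR : 0 < q R)
    (hpos : ∀ᶠ x in atTop, 0 < q x)
    (htail : ∀ η > 0, ∀ᶠ x in atTop, tailConv (halfLineTail q L) hL x ≤ (2 * L + η) * q x)
    {δ : ℝ} (hδ : 0 < δ) : ∀ᶠ x in atTop, q (x - R) ≤ (1 + δ) * q x := by
  have := isFiniteMeasure_negStieltjes hL hq
  -- This `η` solves `q R + η = (1 + δ) (q R - η)`, which closes the comparison once `q x < η`.
  obtain ⟨η, hη, hηR⟩ : ∃ η > 0, η * (2 + δ) = δ * q R :=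
    ⟨δ * q R / (2 + δ), by positivity, by field_simp⟩
  filter_upwards [htail η hη, hpos, hq.eventually (gt_mem_nhds hη),
    eventually_ge_atTop (2 * R)] with x h1 h2 h3 h4
  have hRx : R ≤ x := by linarith
  have h5 := setIntegral_add_le_tailConv hL hq hR hRx (hc R le_rfl) (hc x hRx) Subset.rfl
  have h6 : (q R - q x) * q (x - R) ≤
      ∫ y in Ioc R x, halfLineTail q L (x - y) ∂(negStieltjes (halfLineTail q L) hL) := by
    rw [← negStieltjes_Ioc hL hR hRx (hc R le_rfl) (hc x hRx), ← smul_eq_mul,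
      ← setIntegral_const]
    refine setIntegral_mono_on (integrable_const _).integrableOn
      (integrable_halfLineTail_comp_sub hL hq x).integrableOn measurableSet_Ioc fun y hy => ?_
    rw [← halfLineTail_of_nonneg (q := q) (L := L) (by linarith : 0 ≤ x - R)]
    exact hL (by linarith [hy.1])
  have h7 : (q R - q x) * q (x - R) ≤ (q R + η) * q x := by linarith
  have h8 : (q R + η) * q x ≤ (q R - q x) * ((1 + δ) * q x) := by
    rw [← mul_assoc]
    exact mul_le_mul_of_nonneg_right (by nlinarith) h2.le
  have h9 : 0 < q R - q x := by nlinarith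
  exact le_of_mul_le_mul_left (h7.trans h8) h9

theorem SubexpDistribution.realConv_convPow_le {a u q : ℝ → ℝ}
    (ha : ∀ᵐ x, 0 ≤ a x) (hai : Integrable a) (ha1 : ∫ x, a x = 1) (hu : MemLp u ⊤)
    (hqa : Antitone q) (hs : SubexpDistribution q) {ρ : ℝ} (hρ : 0 < ρ)
    (hqc : ContinuousOn q (Ici ρ))
    (hle : ∀ᵐ x : ℝ, ρ ≤ x → max (∫ y in Ioi x, a y) (u x) ≤ q x) {ε : ℝ} (hε : 0 < ε)
    (hε1 : ε < 1) :
    ∃ C X : ℝ, 0 < C ∧ 0 < X ∧ ∀ x : ℝ, X < x → ∀ n : ℕ, 1 ≤ n →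
      realConv (convPow a n) u x ≤ C * (1 + ε) ^ n * q x := by
  obtain ⟨L, hL, -, hconv⟩ := hs.conv_equiv
  have hq := hs.tendsto_zero
  have := isFiniteMeasure_negStieltjes hL hq
  obtain ⟨-, hpos, htail⟩ := hconv.eventually_le
    ((halfLineTail_nonneg hL hq 0).trans (halfLineTail_le hL 0)) hs.nonneg
  have hq0 : ∀ x, 0 < q x := fun x => by
    obtain ⟨y, hy, hxy⟩ := (hpos.and (eventually_ge_atTop x)).exists
    exact hy.trans_le (hqa hxy)
  have hcont : ∀ x, ρ < x → ContinuousAt q x := fun x hx => hqc.continuousAt (Ici_mem_nhds hx)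
  have hA : ∀ x, ρ < x → ∫ y in Ioi x, a y ≤ q x := fun x hx =>
    integral_Ioi_le_of_ae ha hai
      (hle.mono fun z hz hz' => (le_max_left _ _).trans (hz hz')) hx (hcont x hx)
  -- The pieces add up to `(1 + 2δ)(1 + δ) + 2δ = 1 + 5δ + 2δ²` times `q x`, which is below `1 +
  -- 10δ`.
  set δ := ε / 10 with hδ
  have hδ0 : 0 < δ := by positivity
  obtain ⟨R, hqR, hρR⟩ := ((hq.eventually (gt_mem_nhds hδ0)).and (eventually_gt_atTop ρ)).exists
  have hR : 0 < R := hρ.trans hρR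
  have hcR : ∀ y ≥ R, ContinuousAt q y := fun y hy => hcont y (hρR.trans_le hy)
  obtain ⟨X, hX⟩ := eventually_atTop.1
    ((eventually_comp_sub_le hL hq hR hcR (hq0 R) hpos htail hδ0).and
      ((htail δ hδ0).and (eventually_ge_atTop (2 * R))))
  -- The bound `δ` makes the last piece small; since `q` decreases, the other two turn `q x < l`
  -- into `x ≥ X` and `x ≥ ρ`.
  set l := min δ (min (q X) (q ρ)) with hl
  have hl0 : 0 < l := lt_min hδ0 (lt_min (hq0 X) (hq0 ρ))
  have hlX : l ≤ q X := (min_le_right _ _).trans (min_le_left _ _)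
  have hlρ : l ≤ q ρ := (min_le_right _ _).trans (min_le_right _ _)
  set w : ℝ → ℝ := fun x => min l (q x) with hw
  have hw0 : ∀ x, 0 ≤ w x := fun x => le_min hl0.le (hs.nonneg x)
  have hwl : ∀ x, w x ≤ l := fun x => min_le_left _ _
  have hwq : ∀ x, w x ≤ q x := fun x => min_le_right _ _
  have hwtop : MemLp w ⊤ := memLp_top_of_bound
    (measurable_const.min hqa.measurable).aestronglyMeasurable l
    (Eventually.of_forall fun x => by rw [Real.norm_of_nonneg (hw0 x)]; exact hwl x)
  have haw : ∀ x, realConv a w x ≤ (1 + ε) * w x := by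
    intro x
    rcases le_or_gt l (q x) with h | h
    · rw [hw]
      simp only [min_eq_left h]
      have := realConv_le_of_le ha hai ha1 hwtop hwl x
      nlinarith
    have hXx : X ≤ x := by
      by_contra! hlt
      linarith [hqa hlt.le]
    obtain ⟨e1, e2, e3⟩ := hX x hXx
    have hI := integrable_realConv_integrand hai hwtop x
    have f1 : ∫ y in Iic R, a y * w (x - y) ≤ q (x - R) := by
      refine (setIntegral_mono_on_ae (g := fun y => a y * q (x - R)) hI.integrableOn
        (hai.mul_const _).integrableOn measurableSet_Iic ?_).trans ?_
      · filter_upwards [ha] with y hy hyR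
        exact mul_le_mul_of_nonneg_left
          ((hwq _).trans (hqa (by linarith [mem_Iic.1 hyR]))) hy
      · rw [integral_mul_const]
        exact mul_le_of_le_one_left (hs.nonneg _) (ha1 ▸ setIntegral_le_integral hai ha)
    have f2 : ∫ y in Ioc R (x - R), a y * w (x - y) ≤
        ∫ y in Ioc R (x - R), a y * q (x - y) := by
      refine setIntegral_mono_on_ae hI.integrableOn ?_ measurableSet_Ioc ?_
      · refine (Integrable.bdd_mul (c := q R) hai.integrableOn (hqa.measurable.comp
          (measurable_const.sub measurable_id)).aestronglyMeasurable ?_).congr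
          (Eventually.of_forall fun y => mul_comm _ _)
        filter_upwards [ae_restrict_mem measurableSet_Ioc] with y hy
        refine (Real.norm_of_nonneg (hs.nonneg _)).trans_le ?_
        exact hqa (by simpa using (by linarith [hy.2] : R ≤ x - y))
      · filter_upwards [ha] with y hy _
        exact mul_le_mul_of_nonneg_left (hwq _) hy
    have f3 : ∫ y in Ioi (x - R), a y * w (x - y) ≤ δ * q (x - R) := by
      refine (setIntegral_mono_on_ae (g := fun y => δ * a y) hI.integrableOn
        (hai.const_mul _).integrableOn measurableSet_Ioi ?_).trans ?_
      · filter_upwards [ha] with y hy _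
        rw [mul_comm]
        exact mul_le_mul_of_nonneg_right ((hwl _).trans (min_le_left _ _)) hy
      · rw [integral_const_mul]
        exact mul_le_mul_of_nonneg_left (hA _ (by linarith)) hδ0.le
    have f4 := setIntegral_mul_comp_sub_le hL hq ha hai hR e3 hcR
      (fun y hy => hA y (hρR.trans_le hy))
    -- Against `e2`, the terms `2 L q x` cancel, leaving at most `(δ + q R) q x` for the middle
    -- Stieltjes integral.
    have f5 := setIntegral_add_le_tailConv hL hq hR (by linarith : R ≤ x) (hcR R le_rfl)
      (hcR x (by linarith)) (Ioc_subset_Ioc_right (by linarith : x - R ≤ x))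
    have split : realConv a w x = (∫ y in Iic R, a y * w (x - y)) +
        ((∫ y in Ioc R (x - R), a y * w (x - y)) + ∫ y in Ioi (x - R), a y * w (x - y)) := by
      rw [realConv_eq_integral, ← setIntegral_union (Ioc_disjoint_Ioi le_rfl) measurableSet_Ioi
        hI.integrableOn hI.integrableOn, Ioc_union_Ioi_eq_Ioi (by linarith), ← compl_Iic,
        integral_add_compl measurableSet_Iic hI]
    have hwx : w x = q x := min_eq_right h.le
    rw [hwx, split]
    have hqx := hq0 x
    have g1 : q (x - R) * q R ≤ δ * q (x - R) := by
      rw [mul_comm]; exact mul_le_mul_of_nonneg_right hqR.le (hs.nonneg _)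
    have g2 : q R * q x ≤ δ * q x := mul_le_mul_of_nonneg_right hqR.le hqx.le
    have g3 : (1 + 2 * δ) * q (x - R) ≤ (1 + 2 * δ) * ((1 + δ) * q x) :=
      mul_le_mul_of_nonneg_left e1 (by positivity)
    have g4 : ((1 + 2 * δ) * (1 + δ) + 2 * δ) * q x ≤ (1 + ε) * q x :=
      mul_le_mul_of_nonneg_right (by nlinarith) hqx.le
    linarith
  obtain ⟨M, hM, huM⟩ := hu.exists_ae_abs_le
  have hC : 0 < 1 + M / l := by positivity
  have huw : ∀ᵐ x, u x ≤ (1 + M / l) * w x := by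
    filter_upwards [huM, hle] with x hx hx'
    rcases le_or_gt l (q x) with h | h
    · rw [show w x = l from min_eq_left h, add_mul, div_mul_cancel₀ _ hl0.ne']
      linarith [le_abs_self (u x)]
    · rw [show w x = q x from min_eq_right h.le]
      have hρx : ρ ≤ x := by
        by_contra! hlt
        linarith [hqa hlt.le]
      have h1 := (le_max_right _ _).trans (hx' hρx)
      have h2 := mul_nonneg (div_nonneg hM hl0.le) (hs.nonneg x)
      linarith
  -- The threshold `1` is arbitrary: `w ≤ q` on the whole line.
  refine ⟨1 + M / l, 1, hC, one_pos, fun x _ n hn => ?_⟩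
  refine (_root_.realConv_convPow_le ha hai hu hwtop (by linarith) hC.le haw huw n hn x).trans ?_
  exact mul_le_mul_of_nonneg_left (hwq x) (by positivity)

theorem proposition5p1
    (a u₀ : ℝ → ℝ)
    -- the kernel `a` is a bounded probability density
    (ha_nonneg : ∀ᵐ x, 0 ≤ a x) (ha_int : Integrable a) (ha_bdd : MemLp a ⊤)
    (ha_one : ∫ x, a x = 1)
    -- the initial condition `u₀` is nonnegative and belongs to `L^∞`
    (hu_nonneg : ∀ x, 0 ≤ u₀ x) (hu_bdd : MemLp u₀ ⊤) :
    (VanishesAtInfinity u₀ →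
      ∀ p : ℝ → ℝ, Integrable p → SubexpDensity p → SubexpDensity (fun s => p (-s)) →
      ∀ ρ K : ℝ, 0 < ρ → 0 < K →
      (∀ x τ : ℝ, ρ ≤ x → 0 ≤ τ →
        p (x + τ) ≤ K * p x ∧ p (-x - τ) ≤ K * p (-x)) →
      (∀ᵐ x : ℝ, ρ ≤ |x| → max (a x) (u₀ x) ≤ p x) →
      ∀ ε : ℝ, 0 < ε → ε < 1 →
        ∃ C xε : ℝ, 0 < C ∧ 0 < xε ∧ ∀ x : ℝ, xε < |x| → ∀ n : ℕ, 1 ≤ n →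
          realConv (convPow a n) u₀ x ≤ C * (1 + ε) ^ n * p x) ∧
    (FrontLike u₀ → BoundedVariationOn u₀ univ →
      ∀ q : ℝ → ℝ, MemLp q ⊤ → Antitone q → Tendsto q atTop (𝓝 0) →
      SubexpDistribution q →
      ∀ ρ : ℝ, 0 < ρ → ContinuousOn q (Ici ρ) →
      (∀ᵐ x : ℝ, ρ ≤ x → max (∫ y in Ioi x, a y) (u₀ x) ≤ q x) →
      ∀ ε : ℝ, 0 < ε → ε < 1 →
        ∃ C xε : ℝ, 0 < C ∧ 0 < xε ∧ ∀ x : ℝ, xε < x → ∀ n : ℕ, 1 ≤ n →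
          realConv (convPow a n) u₀ x ≤ C * (1 + ε) ^ n * q x) := by
  refine ⟨fun _ p hpi hs hs' ρ K hρ hK hmono hle ε hε _ =>
    hs.realConv_convPow_le ha_nonneg ha_int ha_one hu_bdd hpi hs' hρ hK hmono hle hε,
    fun _ _ q _ hqa _ hs ρ hρ hqc hle ε hε hε1 =>
    hs.realConv_convPow_le ha_nonneg ha_int ha_one hu_bdd hqa hρ hqc hle hε hε1⟩
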